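/- Let $A\in\mathbb{C}^{N\times N}$. For delays $m=(m_1,\dots,m_N)$, where each $m_i$ is a positive integer, let $$p_{A,m}(z)=\det\bigl(\operatorname{diag}(z^{m_1},\dots,z^{m_N})-A\bigr)$$ be the generalized characteristic polynomial of $A$. The matrix $A$ is called \emph{unilossless} if, for every choice of positive integer delays $m$, all complex roots of $p_{A,m}$ have modulus $1$. It is called \emph{irreducible} if there is no permutation matrix $P$ such that $P^{-1}AP=\begin{bmatrix}E&G\\0&F\end{bmatrix}$ with non-empty square diagonal blocks $E$ and $F$. If $A$ is irreducible and unilossless, then there exists a non-singular diagonal matrix $E\in\mathbb{C}^{N\times N}$ with $$A\,E\,A^{H}=E,$$ where $A^{H}$ denotes the conjugate transpose of $A$. -/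

import Mathlib

namespace FDN

open Polynomial

/-- The generalized characteristic polynomial `det (diag (z ^ m₁, …, z ^ m_N) - A)` of a feedback
matrix `A` with delays `m`. -/
noncomputable def genCharPoly {N : ℕ} (A : Matrix (Fin N) (Fin N) ℂ) (m : Fin N → ℕ) : ℂ[X] :=
  (Matrix.diagonal (fun i => (X : ℂ[X]) ^ m i) - A.map C).det

/-- A polynomial is lossless if all its complex roots have modulus `1`. -/
def IsLossless (p : ℂ[X]) : Prop :=
  ∀ z : ℂ, p.IsRoot z → ‖z‖ = 1

/-- `A` is unilossless if its generalized characteristic polynomial is lossless for every choice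
of (positive integer) delays. -/
def IsUnilossless {N : ℕ} (A : Matrix (Fin N) (Fin N) ℂ) : Prop :=
  ∀ m : Fin N → ℕ, (∀ i, 0 < m i) → IsLossless (genCharPoly A m)

/-- `A` is reducible if a simultaneous permutation of its rows and columns brings it to the block
triangular form `[E G; 0 F]` with non-empty square diagonal blocks `E` and `F`. -/
def IsReducible {N : ℕ} (A : Matrix (Fin N) (Fin N) ℂ) : Prop :=
  ∃ (r s : ℕ) (_ : 0 < r) (_ : 0 < s) (e : Fin r ⊕ Fin s ≃ Fin N)
    (E : Matrix (Fin r) (Fin r) ℂ) (G : Matrix (Fin r) (Fin s) ℂ) (F : Matrix (Fin s) (Fin s) ℂ),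
    A.submatrix e e = Matrix.fromBlocks E G 0 F

/-- `A` is irreducible if it is not reducible. -/
def IsIrreducible {N : ℕ} (A : Matrix (Fin N) (Fin N) ℂ) : Prop :=
  ¬ IsReducible A

end FDN

/-! Let R = -i(1 + cA)(1 - cA)⁻¹, where |c| = 1 is chosen to make 1 - cA invertible. Then R E = E Rᴴ
implies A E Aᴴ = E, so it suffices to conjugate R to Rᴴ by a diagonal matrix. Irreducibility of A
passes to R, and such a matrix exists once every closed walk has the same weight in R and in Rᴴ: its
entry at j is the ratio of the two weights of a walk from a base vertex to j
(`IsBistable.exists_symmetrizer`).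

The walk identity comes from zero-free regions. For suitable delays the points (ζ ^ mᵢ) with |ζ| < 1
approach any point of the punctured polydisc, so by Hurwitz det (diag z - A) has no zeros in the
polydisc, and likewise for A⁻¹. The Cayley transform turns these two facts into `IsBistable R`.
Hence diag y * R has real spectrum for y > 0, and traces show that R a a is real and R a b * R b a ≥
0. Bistability survives Schur complements with a free real parameter (`IsBistable.eliminate`). A
discriminant in that parameter settles triangles; longer closed walks are split along chords or
shortened by elimination (`IsBistable.walkWeight_closed`). -/

namespace FDN

open Matrix Filter Topology Polynomial

/-! ### Stable matrices -/

/-- The Schur complement of the entry `b`, with the pivot replaced by `t⁻¹`, extended by a zero row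
and a zero column at `b`. -/
def eliminate {ι : Type*} [DecidableEq ι] (R : Matrix ι ι ℂ) (b : ι) (t : ℂ) : Matrix ι ι ℂ :=
  of fun i j => if i = b ∨ j = b then 0 else R i j - t * (R i b * R b j)

theorem eliminate_apply_of_ne {ι : Type*} [DecidableEq ι] (R : Matrix ι ι ℂ) {b i j : ι} (t : ℂ)
    (hi : i ≠ b) (hj : j ≠ b) :
    eliminate R b t i j = R i j - t * (R i b * R b j) := by
  simp [eliminate, hi, hj]

theorem eliminate_neg {ι : Type*} [DecidableEq ι] (R : Matrix ι ι ℂ) (b : ι) (t : ℂ) :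
    eliminate (-R) b (-t) = -eliminate R b t := by
  ext i j
  by_cases h : i = b ∨ j = b
  · simp [eliminate, h]
  · simp [eliminate, h]; ring

section Stable

variable {ι : Type*} [Fintype ι] [DecidableEq ι]

/-- `det (diag x + R)` does not vanish when all `x i` lie in the open upper half plane. -/
def IsStable (R : Matrix ι ι ℂ) : Prop :=
  ∀ x : ι → ℂ, (∀ i, 0 < (x i).im) → (diagonal x + R).det ≠ 0

/-- `det (diag x + R)` vanishes neither on the product of the upper half planes nor on the product
of the lower half planes. -/
def IsBistable (R : Matrix ι ι ℂ) : Prop :=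
  IsStable R ∧ IsStable (-R)

/-- Every eigenvalue of diag x + R has modulus at least ε, since subtracting a smaller number from
all x i stays in the upper half plane. The bound does not depend on R, so stability passes to
limits. -/
theorem IsStable.pow_le_norm_det {R : Matrix ι ι ℂ} (h : IsStable R) {ε : ℝ} (hε : 0 < ε)
    {x : ι → ℂ} (hx : ∀ i, ε ≤ (x i).im) :
    ε ^ Fintype.card ι ≤ ‖(diagonal x + R).det‖ := by
  have hroot : ∀ z ∈ (diagonal x + R).charpoly.roots, ε ≤ ‖z‖ := by
    intro z hz
    have hz0 := (mem_roots'.1 hz).2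
    rw [IsRoot, eval_charpoly] at hz0
    by_contra! hlt
    have him : z.im < ε := (le_abs_self _).trans_lt ((Complex.abs_im_le_norm z).trans_lt hlt)
    refine h (fun i => x i - z) (fun i => ?_) ?_
    · rw [Complex.sub_im]; linarith [hx i]
    · have : diagonal (fun i => x i - z) + R = -(scalar ι z - (diagonal x + R)) := by
        rw [← diagonal_sub, scalar_apply]
        abel
      rw [this, det_neg, hz0, mul_zero]
  rw [det_eq_prod_roots_charpoly]
  have hcard : Multiset.card (diagonal x + R).charpoly.roots = Fintype.card ι := by
    rw [← charpoly_natDegree_eq_dim (diagonal x + R)]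
    exact (IsAlgClosed.splits _).natDegree_eq_card_roots.symm
  rw [← hcard]
  generalize (diagonal x + R).charpoly.roots = s at hroot
  induction s using Multiset.induction_on with
  | empty => simp
  | cons a s ih =>
    rw [Multiset.card_cons, Multiset.prod_cons, norm_mul, pow_succ']
    exact mul_le_mul (hroot a (by simp)) (ih fun z hz => hroot z (by simp [hz])) (by positivity)
      (norm_nonneg _)

theorem IsStable.of_tendsto {α : Type*} {l : Filter α} [l.NeBot] {S : α → Matrix ι ι ℂ}
    {R : Matrix ι ι ℂ} (hS : Tendsto S l (𝓝 R)) (h : ∀ᶠ a in l, IsStable (S a)) :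
    IsStable R := by
  intro x hx
  obtain ⟨ε, hε, hxε⟩ : ∃ ε > 0, ∀ i, ε ≤ (x i).im := by
    rcases isEmpty_or_nonempty ι with hι | hι
    · exact ⟨1, one_pos, fun i => isEmptyElim i⟩
    · obtain ⟨j, hj⟩ := Finite.exists_min fun i => (x i).im
      exact ⟨(x j).im, hx j, hj⟩
  have hlim : Tendsto (fun a => ‖(diagonal x + S a).det‖) l (𝓝 ‖(diagonal x + R).det‖) := by
    have hc : Continuous fun M : Matrix ι ι ℂ => ‖(diagonal x + M).det‖ :=
      (Continuous.matrix_det (by fun_prop)).norm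
    exact (hc.tendsto R).comp hS
  have := ge_of_tendsto hlim (h.mono fun a ha => ha.pow_le_norm_det hε hxε)
  exact norm_pos_iff.1 ((pow_pos hε _).trans_le this)

theorem IsStable.add_diagonal {R : Matrix ι ι ℂ} (h : IsStable R) (u : ι → ℝ) :
    IsStable (R + diagonal fun i => (u i : ℂ)) := by
  intro x hx
  have := h (fun i => x i + u i) (by simpa using hx)
  rwa [← diagonal_add, add_assoc, add_comm _ R] at this

theorem IsBistable.add_diagonal {R : Matrix ι ι ℂ} (h : IsBistable R) (u : ι → ℝ) :
    IsBistable (R + diagonal fun i => (u i : ℂ)) := by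
  refine ⟨h.1.add_diagonal u, ?_⟩
  have := h.2.add_diagonal (-u)
  convert this using 1
  ext i j
  by_cases hij : i = j <;> simp [hij, add_comm]

/-- Positive row scalings of a bistable matrix have real spectrum. -/
theorem IsBistable.im_eq_zero_of_mem_spectrum {R : Matrix ι ι ℂ} (h : IsBistable R) {y : ι → ℝ}
    (hy : ∀ i, 0 < y i) {z : ℂ} (hz : z ∈ spectrum ℂ (diagonal (fun i => (y i : ℂ)) * R)) :
    z.im = 0 := by
  rw [mem_spectrum_iff_isRoot_charpoly, IsRoot, eval_charpoly] at hz
  have hfac : scalar ι z - diagonal (fun i => (y i : ℂ)) * R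
      = diagonal (fun i => (y i : ℂ)) * (diagonal (fun i => z / y i) + -R) := by
    rw [mul_add, diagonal_mul_diagonal, mul_neg, sub_eq_add_neg]
    congr 1
    rw [scalar_apply]
    congr 1
    ext i
    rw [mul_div_cancel₀]
    exact_mod_cast (hy i).ne'
  have hydet : (diagonal (fun i => (y i : ℂ))).det ≠ 0 := by
    rw [det_diagonal]
    exact Finset.prod_ne_zero_iff.2 fun i _ => by exact_mod_cast (hy i).ne'
  rw [hfac, det_mul, mul_eq_zero, or_iff_right hydet] at hz
  rcases lt_trichotomy z.im 0 with hlt | heq | hgt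
  · refine absurd ?_ (h.1 (fun i => -(z / y i)) fun i => ?_)
    · have : diagonal (fun i => -(z / (y i : ℂ))) + R
          = -(diagonal (fun i => z / (y i : ℂ)) + -R) := by
        rw [neg_add, neg_neg, diagonal_neg]
      rw [this, det_neg, hz, mul_zero]
    · rw [Complex.neg_im, Complex.div_ofReal_im, neg_pos]
      exact div_neg_of_neg_of_pos hlt (hy i)
  · exact heq
  · refine absurd hz (h.2 _ fun i => ?_)
    rw [Complex.div_ofReal_im]
    exact div_pos hgt (hy i)

theorem IsBistable.im_trace_eq_zero {R : Matrix ι ι ℂ} (h : IsBistable R) {y : ι → ℝ}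
    (hy : ∀ i, 0 < y i) : (trace (diagonal (fun i => (y i : ℂ)) * R)).im = 0 := by
  rw [trace_eq_sum_roots_charpoly]
  refine Multiset.sum_induction (fun z : ℂ => z.im = 0) _ (fun a b ha hb => by simp [ha, hb])
    (by simp) fun z hz => h.im_eq_zero_of_mem_spectrum hy ?_
  exact mem_spectrum_iff_isRoot_charpoly.2 (mem_roots'.1 hz).2

open scoped ComplexOrder in
theorem IsBistable.trace_sq_nonneg {R : Matrix ι ι ℂ} (h : IsBistable R) {y : ι → ℝ}
    (hy : ∀ i, 0 < y i) : 0 ≤ trace ((diagonal (fun i => (y i : ℂ)) * R) ^ 2) := by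
  rw [trace_eq_sum_roots_charpoly]
  refine Multiset.sum_induction (fun z : ℂ => 0 ≤ z) _ (fun a b ha hb => add_nonneg ha hb)
    le_rfl fun z hz => ?_
  have hz' := mem_spectrum_iff_isRoot_charpoly.2 (mem_roots'.1 hz).2
  rw [spectrum.map_pow_of_pos _ two_pos] at hz'
  obtain ⟨w, hw, rfl⟩ := hz'
  have hw0 := h.im_eq_zero_of_mem_spectrum hy hw
  have : w = (w.re : ℂ) := Complex.ext rfl (by simpa using hw0)
  simp only
  rw [this]
  exact_mod_cast sq_nonneg w.re

theorem trace_diagonal_mul_sq (d : ι → ℂ) (S : Matrix ι ι ℂ) :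
    trace ((diagonal d * S) ^ 2) = ∑ i, d i * ∑ j, d j * (S i j * S j i) := by
  rw [pow_two, trace]
  refine Finset.sum_congr rfl fun i _ => ?_
  rw [diag_apply, Matrix.mul_apply, Finset.mul_sum]
  refine Finset.sum_congr rfl fun j _ => ?_
  rw [diagonal_mul, diagonal_mul]
  ring

theorem IsBistable.diag_im_eq_zero {R : Matrix ι ι ℂ} (h : IsBistable R) (a : ι) :
    (R a a).im = 0 := by
  -- The weights must be positive; as ε → 0 they concentrate at a, and the trace tends to R a a.
  let y : ℝ → ι → ℝ := fun ε i => (if i = a then 1 else 0) + ε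
  have hlim : Tendsto (fun ε => (trace (diagonal (fun i => (y ε i : ℂ)) * R)).im) (𝓝[>] 0)
      (𝓝 (trace (diagonal (fun i => (y 0 i : ℂ)) * R)).im) := by
    have hc : Continuous fun ε => (trace (diagonal (fun i => (y ε i : ℂ)) * R)).im := by
      simp only [trace, diag_apply, diagonal_mul, y]
      fun_prop
    exact (hc.tendsto 0).mono_left nhdsWithin_le_nhds
  have hev : ∀ᶠ ε in 𝓝[>] (0 : ℝ), (trace (diagonal (fun i => (y ε i : ℂ)) * R)).im = 0 := by
    filter_upwards [self_mem_nhdsWithin] with ε hε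
    refine h.im_trace_eq_zero fun i => ?_
    have : (0 : ℝ) < ε := hε
    simp only [y]; split_ifs <;> linarith
  have := tendsto_nhds_unique (tendsto_const_nhds.congr' (hev.mono fun _ h => h.symm)) hlim
  simpa [trace, y] using this.symm

open scoped ComplexOrder in
theorem IsBistable.mul_apply_nonneg {R : Matrix ι ι ℂ} (h : IsBistable R) (a b : ι) :
    0 ≤ R a b * R b a := by
  rcases eq_or_ne a b with rfl | hab
  · have : R a a = ((R a a).re : ℂ) := Complex.ext rfl (by simpa using h.diag_im_eq_zero a)
    rw [this]
    exact_mod_cast mul_self_nonneg _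
  -- Removing the real diagonal leaves only the 2-cycle through a and b in the limiting trace of the
  -- square.
  let S : Matrix ι ι ℂ := R + diagonal fun i => ((-(R i i).re : ℝ) : ℂ)
  have hS : IsBistable S := h.add_diagonal _
  have hSd : ∀ i, S i i = 0 := fun i => by
    apply Complex.ext <;> simp [S, h.diag_im_eq_zero]
  have hSo : ∀ i j, i ≠ j → S i j = R i j := fun i j hij => by simp [S, hij]
  let y : ℝ → ι → ℝ := fun ε i => (if i = a ∨ i = b then 1 else 0) + ε
  have hlim : Tendsto (fun ε => trace ((diagonal (fun i => (y ε i : ℂ)) * S) ^ 2)) (𝓝[>] 0)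
      (𝓝 (trace ((diagonal (fun i => (y 0 i : ℂ)) * S) ^ 2))) := by
    have hc : Continuous fun ε => trace ((diagonal (fun i => (y ε i : ℂ)) * S) ^ 2) := by
      simp only [trace_diagonal_mul_sq, y]
      fun_prop
    exact (hc.tendsto 0).mono_left nhdsWithin_le_nhds
  have hev : ∀ᶠ ε in 𝓝[>] (0 : ℝ), 0 ≤ trace ((diagonal (fun i => (y ε i : ℂ)) * S) ^ 2) := by
    filter_upwards [self_mem_nhdsWithin] with ε hε
    refine hS.trace_sq_nonneg fun i => ?_
    have : (0 : ℝ) < ε := hε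
    simp only [y]; split_ifs <;> linarith
  have hnn := ge_of_tendsto hlim hev
  have hsum : trace ((diagonal (fun i => (y 0 i : ℂ)) * S) ^ 2) = 2 * (R a b * R b a) := by
    have hind : ∀ i, (y 0 i : ℂ) = (if i = a then 1 else 0) + if i = b then 1 else 0 := by
      intro i
      rcases eq_or_ne i a with rfl | hia
      · simp [y, hab]
      · by_cases hib : i = b <;> simp [y, hia, hib, hab.symm]
    simp only [trace_diagonal_mul_sq, hind, add_mul, ite_mul, one_mul, zero_mul,
      Finset.sum_add_distrib, Finset.sum_ite_eq', Finset.mem_univ, if_true, hSd,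
      hSo _ _ hab, hSo _ _ hab.symm]
    ring
  rw [hsum] at hnn
  have h2 : (0 : ℂ) ≤ ((2⁻¹ : ℝ) : ℂ) := by
    exact_mod_cast (by norm_num : (0 : ℝ) ≤ 2⁻¹)
  have := mul_nonneg h2 hnn
  rwa [← mul_assoc, show (((2⁻¹ : ℝ) : ℂ) * 2) = 1 by norm_num, one_mul] at this

/-- A kernel vector of the Schur complement lifts to one of the full matrix. -/
theorem IsStable.eliminate_of_im_neg {R : Matrix ι ι ℂ} (h : IsStable R) {b : ι}
    (hb : (R b b).im = 0) {t : ℂ} (ht : t.im < 0) : IsStable (eliminate R b t) := by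
  intro x hx hdet
  obtain ⟨v, hv0, hv⟩ := exists_mulVec_eq_zero_iff.2 hdet
  have ht0 : t ≠ 0 := by rintro rfl; simp at ht
  have hrow : ∀ i, x i * v i + ∑ j, eliminate R b t i j * v j = 0 := fun i => by
    have := congrFun hv i
    rwa [add_mulVec, Pi.add_apply, mulVec_diagonal, Pi.zero_apply] at this
  have hvb : v b = 0 := by
    have := hrow b
    simp only [eliminate, of_apply, true_or, if_true, zero_mul, Finset.sum_const_zero,
      add_zero, mul_eq_zero] at this
    refine this.resolve_left fun h0 => ?_
    have := hx b
    simp [h0] at this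
  set s := ∑ j, R b j * v j with hs
  have hrow' : ∀ i, i ≠ b → x i * v i + ∑ j, R i j * v j - t * s * R i b = 0 := fun i hi => by
    rw [← hrow i, hs, add_sub_assoc, Finset.mul_sum, Finset.sum_mul, ← Finset.sum_sub_distrib]
    congr 1
    refine Finset.sum_congr rfl fun j _ => ?_
    rcases eq_or_ne j b with rfl | hj
    · simp [hvb]
    · rw [eliminate_apply_of_ne R t hi hj]; ring
  -- The pivot x' b + R b b is t⁻¹, and x' b lies in the upper half plane because Im t < 0 and R b b
  -- is real. Row b then forces the entry -t * s at b.
  let x' := Function.update x b (t⁻¹ - R b b)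
  refine h x' (fun i => ?_) (exists_mulVec_eq_zero_iff.1 ⟨v - Pi.single b (t * s), ?_, ?_⟩)
  · rcases eq_or_ne i b with rfl | hi
    · simp only [x', Function.update_self, Complex.sub_im, hb, sub_zero, Complex.inv_im]
      exact div_pos (neg_pos.2 ht) (Complex.normSq_pos.2 ht0)
    · simpa [x', hi] using hx i
  · intro h0
    apply hv0
    ext i
    rcases eq_or_ne i b with rfl | hi
    · exact hvb
    · simpa [hi] using congrFun h0 i
  · ext i
    rw [add_mulVec, Pi.add_apply, mulVec_diagonal, mulVec_sub, Pi.sub_apply, mulVec_single]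
    rcases eq_or_ne i b with rfl | hi
    · simp [x', hvb, mulVec, dotProduct, ← hs]
      field_simp
      ring
    · have := hrow' i hi
      simp [x', hi, mulVec, dotProduct]
      linear_combination this

/-- Real t is a boundary value of Im t < 0. -/
theorem IsStable.eliminate {R : Matrix ι ι ℂ} (h : IsStable R) {b : ι} (hb : (R b b).im = 0)
    (t : ℝ) : IsStable (eliminate R b t) := by
  refine IsStable.of_tendsto (l := 𝓝[>] (0 : ℝ))
    (S := fun ε => FDN.eliminate R b (t - ε * Complex.I)) ?_ ?_
  · have hc : Continuous fun ε : ℝ => FDN.eliminate R b (t - ε * Complex.I) := by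
      refine continuous_matrix fun i j => ?_
      by_cases hij : i = b ∨ j = b
      · simp [FDN.eliminate, hij, continuous_const]
      · simp only [FDN.eliminate, hij, of_apply, if_false]
        fun_prop
    have := hc.tendsto 0
    simp only [Complex.ofReal_zero, zero_mul, sub_zero] at this
    exact this.mono_left nhdsWithin_le_nhds
  · filter_upwards [self_mem_nhdsWithin] with ε hε
    refine h.eliminate_of_im_neg hb ?_
    simpa using hε

theorem IsBistable.eliminate {R : Matrix ι ι ℂ} (h : IsBistable R) (b : ι) (t : ℝ) :
    IsBistable (eliminate R b t) := by
  refine ⟨h.1.eliminate (h.diag_im_eq_zero b) t, ?_⟩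
  rw [← eliminate_neg]
  have := h.2.eliminate (b := b) (by simpa using h.diag_im_eq_zero b) (-t)
  simpa using this

end Stable

end FDN

namespace FDN

open Matrix

/-! ### Weights of closed walks -/

section Walks

/-- The weight of the walk from `a` to `b` through the vertices of the list. -/
def walkWeight {ι : Type*} (R : Matrix ι ι ℂ) : ι → List ι → ι → ℂ
  | a, [], b => R a b
  | a, c :: l, b => R a c * walkWeight R c l b

theorem walkWeight_append {ι : Type*} (R : Matrix ι ι ℂ) (a c b : ι) (l₁ l₂ : List ι) :
    walkWeight R a (l₁ ++ c :: l₂) b = walkWeight R a l₁ c * walkWeight R c l₂ b := by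
  induction l₁ generalizing a with
  | nil => rfl
  | cons d l ih => simp only [List.cons_append, walkWeight, ih, mul_assoc]

theorem walkWeight_congr {ι : Type*} {R S : Matrix ι ι ℂ} {a b : ι} {l : List ι}
    (ha : ∀ y ∈ l ++ [b], R a y = S a y) (hl : ∀ x ∈ l, ∀ y ∈ l ++ [b], R x y = S x y) :
    walkWeight R a l b = walkWeight S a l b := by
  induction l generalizing a with
  | nil => exact ha b (by simp)
  | cons c l ih =>
    rw [walkWeight, walkWeight, ha c (by simp), ih]
    · exact fun y hy => hl c (by simp) y (by simp at hy ⊢; tauto)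
    · exact fun x hx y hy => hl x (by simp [hx]) y (by simp at hy ⊢; tauto)

/-- P and Q are the two arcs of a closed walk and r, s the two directions of a chord closing them
up. If both directions are nonzero, multiply and cancel; if just one is, both products vanish. -/
theorem mul_eq_mul_of_chord {P Q P' Q' r s r' s' : ℂ} (hne : r ≠ 0 ∨ s ≠ 0)
    (hr : r' = 0 ↔ r = 0) (hs : s' = 0 ↔ s = 0) (hrs : r * s = s' * r') (hP : P * s = P' * r')
    (hQ : Q * r = Q' * s') : P * Q = P' * Q' := by
  rcases eq_or_ne r 0 with h0 | h0
  · have hs0 := hne.resolve_left (not_not.2 h0)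
    rw [hr.2 h0, mul_zero, mul_eq_zero, or_iff_left hs0] at hP
    rw [h0, mul_zero, eq_comm, mul_eq_zero, or_iff_left (hs.not.2 hs0)] at hQ
    rw [hP, hQ, zero_mul, mul_zero]
  rcases eq_or_ne s 0 with h1 | h1
  · rw [h1, mul_zero, eq_comm, mul_eq_zero, or_iff_left (hr.not.2 h0)] at hP
    rw [hs.2 h1, mul_zero, mul_eq_zero, or_iff_left h0] at hQ
    rw [hP, hQ, zero_mul, mul_zero]
  · refine mul_right_cancel₀ (mul_ne_zero h0 h1) ?_
    linear_combination hP * Q * r + P' * r' * hQ - P' * Q' * hrs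

theorem conjTranspose_eliminate {ι : Type*} [DecidableEq ι] (R : Matrix ι ι ℂ) (b : ι) (t : ℝ) :
    (eliminate R b t)ᴴ = eliminate Rᴴ b t := by
  ext i j
  by_cases h : i = b ∨ j = b
  · simp [eliminate, h, or_comm.1 h]
  · simp [eliminate, h, mt or_comm.1 h]
    exact Or.inl (mul_comm _ _)

/-- Eliminating a vertex of a closed walk that is not joined to the rest of the walk except to its
two neighbours shortens the walk and changes the sign of its weight. -/
theorem walkWeight_eliminate {ι : Type*} [DecidableEq ι] {R : Matrix ι ι ℂ} {a b c d : ι}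
    {l : List ι} (hab : a ≠ b) (hcb : c ≠ b) (hac : R a c = 0) (hne : ∀ x ∈ d :: l, x ≠ b)
    (h0 : ∀ x ∈ d :: l, R b x = 0 ∧ R x b = 0) :
    walkWeight (eliminate R b 1) a (c :: d :: l) a = -walkWeight R a (b :: c :: d :: l) a := by
  have hne' : ∀ y ∈ l ++ [a], y ≠ b := by
    intro y hy
    rcases List.mem_append.1 hy with hy | hy
    · exact hne y (by simp [hy])
    · rwa [List.mem_singleton.1 hy]
  have hrow : ∀ x ∈ d :: l, ∀ y ∈ l ++ [a], eliminate R b 1 x y = R x y := fun x hx y hy => by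
    rw [eliminate_apply_of_ne R _ (hne x hx) (hne' y hy), (h0 x hx).2]
    ring
  have hd : d ∈ d :: l := by simp
  simp only [walkWeight]
  rw [walkWeight_congr (hrow d hd) fun x hx => hrow x (by simp [hx]),
    eliminate_apply_of_ne R _ hab hcb, eliminate_apply_of_ne R _ hcb (hne d hd), (h0 d hd).1, hac]
  ring

/-- Two complex numbers with real sum and real product that are not distinct reals are conjugate. -/
theorem eq_conj_of_sq_le {x y : ℂ} {σ π : ℝ} (hσ : x + y = σ) (hπ : x * y = π)
    (h : σ ^ 2 ≤ 4 * π) : y = star x := by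
  have h1 := congrArg Complex.re hσ
  have h2 := congrArg Complex.im hσ
  have h3 := congrArg Complex.re hπ
  have h4 := congrArg Complex.im hπ
  simp only [Complex.add_re, Complex.add_im, Complex.mul_re, Complex.mul_im, Complex.ofReal_re,
    Complex.ofReal_im] at h1 h2 h3 h4
  have hy : y.im = -x.im := by linarith
  have hx : x.re = y.re := by
    rw [hy] at h3 h4
    have h5 : x.im * (y.re - x.re) = 0 := by linarith
    rcases mul_eq_zero.1 h5 with h0 | h0
    · rw [h0] at h3
      have : (x.re - y.re) ^ 2 ≤ 0 := by
        rw [← h1, ← h3] at h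
        linarith
      exact sub_eq_zero.1 (pow_eq_zero_iff two_ne_zero |>.1 (le_antisymm this (sq_nonneg _)))
    · linarith
  apply Complex.ext <;> simp [hx, hy]

variable {ι : Type*} [Fintype ι] [DecidableEq ι]

theorem IsBistable.exists_mul_apply_eq {R : Matrix ι ι ℂ} (h : IsBistable R) (a b : ι) :
    ∃ r : ℝ, 0 ≤ r ∧ R a b * R b a = r := by
  have := Complex.le_def.1 (h.mul_apply_nonneg a b)
  exact ⟨_, this.1, Complex.ext rfl this.2.symm⟩

theorem IsBistable.walkWeight_pair {R : Matrix ι ι ℂ} (h : IsBistable R) (a b : ι) :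
    R a b * R b a = Rᴴ a b * Rᴴ b a := by
  obtain ⟨r, -, hr⟩ := h.exists_mul_apply_eq a b
  rw [conjTranspose_apply, conjTranspose_apply, ← star_mul, hr]
  simp

/-- After eliminating b with parameter t, the 2-cycle through a and c is α - σ t + β γ t², with σ
the sum of the triangle weight and its reverse. It is nonnegative for all real t, so σ² ≤ 4αβγ. The
two weights have sum σ and product αβγ, hence are conjugate. -/
theorem IsBistable.walkWeight_triangle {R : Matrix ι ι ℂ} (h : IsBistable R) {a b c : ι}
    (hab : a ≠ b) (hcb : c ≠ b) :
    R a b * (R b c * R c a) = Rᴴ a b * (Rᴴ b c * Rᴴ c a) := by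
  obtain ⟨α, -, hα⟩ := h.exists_mul_apply_eq a c
  obtain ⟨β, -, hβ⟩ := h.exists_mul_apply_eq a b
  obtain ⟨γ, -, hγ⟩ := h.exists_mul_apply_eq b c
  have key : ∀ t : ℝ, ∃ r : ℝ, 0 ≤ r ∧
      (α : ℂ) - t * (R a b * (R b c * R c a) + R a c * (R c b * R b a)) + t * t * (β * γ) = r := by
    intro t
    obtain ⟨r, hr, hr'⟩ := (h.eliminate b t).exists_mul_apply_eq a c
    refine ⟨r, hr, ?_⟩
    rw [eliminate_apply_of_ne R _ hab hcb, eliminate_apply_of_ne R _ hcb hab] at hr'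
    rw [← hr', ← hα, ← hβ, ← hγ]
    ring
  obtain ⟨σ, hσ⟩ : ∃ σ : ℝ, R a b * (R b c * R c a) + R a c * (R c b * R b a) = σ := by
    obtain ⟨r, -, hr⟩ := key 1
    refine ⟨α + β * γ - r, ?_⟩
    push_cast at hr ⊢
    linear_combination -hr
  have hquad : ∀ t : ℝ, 0 ≤ (β * γ) * (t * t) + (-σ) * t + α := by
    intro t
    obtain ⟨r, hr0, hr⟩ := key t
    rw [hσ] at hr
    have : α - t * σ + t * t * (β * γ) = r := by exact_mod_cast hr
    linarith
  have hdisc := discrim_le_zero hquad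
  rw [discrim] at hdisc
  have hprod : R a b * (R b c * R c a) * (R a c * (R c b * R b a)) = ((α * β * γ : ℝ) : ℂ) := by
    push_cast
    rw [← hα, ← hβ, ← hγ]
    ring
  have := eq_conj_of_sq_le hσ hprod (by linarith)
  rw [conjTranspose_apply, conjTranspose_apply, conjTranspose_apply, ← star_star (R a b * _),
    ← this]
  simp only [star_mul']
  ring

/-- The weight of a closed walk is the conjugate of the weight of the reversed walk. -/
theorem IsBistable.walkWeight_closed {R : Matrix ι ι ℂ} (h : IsBistable R) (a : ι) (l : List ι) :
    walkWeight R a l a = walkWeight Rᴴ a l a := by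
  -- R varies in the induction because the last case replaces it by a Schur complement.
  induction hn : l.length using Nat.strong_induction_on generalizing R a l with
  | _ n ih =>
  subst hn
  have ih' : ∀ (a' : ι) (l' : List ι), l'.length < l.length →
      walkWeight R a' l' a' = walkWeight Rᴴ a' l' a' := fun a' l' hl' => ih _ hl' h a' l' rfl
  have hz : ∀ x y, Rᴴ x y = 0 ↔ R y x = 0 := fun x y => by simp
  match l, ih, ih' with
  | [], _, _ =>
    rw [walkWeight, walkWeight, conjTranspose_apply]
    exact Complex.ext (by simp) (by simp [h.diag_im_eq_zero a])
  | [b], _, _ => exact h.walkWeight_pair a b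
  | [b, c], _, ih' =>
    simp only [walkWeight]
    rcases eq_or_ne a b with rfl | hab
    · have h1 := ih' a [] (by simp)
      have h2 := ih' a [c] (by simp)
      simp only [walkWeight] at h1 h2
      rw [h1, h2]
    rcases eq_or_ne c b with rfl | hcb
    · have h1 := ih' c [] (by simp)
      have h2 := ih' a [c] (by simp)
      simp only [walkWeight] at h1 h2
      linear_combination R c c * h2 + Rᴴ a c * Rᴴ c a * h1
    · exact h.walkWeight_triangle hab hcb
  | b :: c :: d :: l, ih, ih' =>
    rcases eq_or_ne a b with rfl | hab
    · have h1 := ih' a [] (by simp)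
      have h2 := ih' a (c :: d :: l) (by simp)
      exact congrArg₂ (· * ·) h1 h2
    rcases eq_or_ne c b with rfl | hcb
    · have h1 := ih' c [] (by simp)
      have h2 := ih' a (c :: d :: l) (by simp)
      simp only [walkWeight] at h1 h2 ⊢
      linear_combination R c c * h2 + Rᴴ a c * (Rᴴ c d * walkWeight Rᴴ d l a) * h1
    -- A second visit to b, or an edge in either direction between b and a later vertex x, splits
    -- the walk into two shorter closed walks.
    by_cases hx : ∃ x ∈ d :: l, x = b ∨ R b x ≠ 0 ∨ R x b ≠ 0
    · obtain ⟨x, hxl, hx⟩ := hx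
      obtain ⟨l₁, l₂, hl⟩ := List.append_of_mem hxl
      have hlen := congrArg List.length hl
      simp only [List.length_append, List.length_cons] at hlen
      have hw : ∀ S : Matrix ι ι ℂ, walkWeight S a (b :: c :: d :: l) a
          = walkWeight S b (c :: l₁) x * (S a b * walkWeight S x l₂ a) := fun S => by
        rw [hl, walkWeight, ← List.cons_append, walkWeight_append]
        ring
      rw [hw, hw]
      rcases eq_or_ne x b with rfl | hxb
      · rw [ih' x (c :: l₁) (by simp only [List.length_cons]; omega)]
        have := ih' a (x :: l₂) (by simp only [List.length_cons]; omega)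
        rw [walkWeight, walkWeight] at this
        rw [this]
      · have h1 := ih' b (c :: l₁ ++ [x]) (by simp; omega)
        have h2 := ih' a (b :: x :: l₂) (by simp; omega)
        rw [walkWeight_append, walkWeight_append] at h1
        simp only [walkWeight] at h1 h2
        refine mul_eq_mul_of_chord (r := R b x) (s := R x b) (r' := Rᴴ x b) (s' := Rᴴ b x)
          (hx.resolve_left hxb) (hz _ _) (hz _ _) (h.walkWeight_pair b x) ?_ ?_
        · simpa only [walkWeight] using h1
        · linear_combination h2
    -- An edge between a and c cuts off the triangle a, b, c.
    by_cases hac : R a c ≠ 0 ∨ R c a ≠ 0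
    · have h1 := ih' a [b, c] (by simp)
      have h2 := ih' a (c :: d :: l) (by simp)
      simp only [walkWeight] at h1 h2 ⊢
      rw [← mul_assoc, ← mul_assoc (Rᴴ a b)]
      refine mul_eq_mul_of_chord (r := R a c) (s := R c a) (r' := Rᴴ c a) (s' := Rᴴ a c)
        hac (hz _ _) (hz _ _) (h.walkWeight_pair a c) ?_ ?_
      · linear_combination h1
      · linear_combination h2
    -- With no chord left, eliminating b only replaces the path a, b, c by an edge, up to sign.
    · push Not at hx hac
      have h1 := ih _ (by simp) (h.eliminate b 1) a (c :: d :: l) rfl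
      rw [conjTranspose_eliminate, Complex.ofReal_one,
        walkWeight_eliminate hab hcb hac.1 (fun x hx' => (hx x hx').1) (fun x hx' => (hx x hx').2),
        walkWeight_eliminate hab hcb ((hz _ _).2 hac.2) (fun x hx' => (hx x hx').1)
          (fun x hx' => ⟨(hz _ _).2 (hx x hx').2.2, (hz _ _).2 (hx x hx').2.1⟩)] at h1
      exact neg_injective h1

end Walks

end FDN

namespace FDN

open Matrix Filter Topology Metric

/-! ### Unilossless matrices and the polydisc -/

section Polydisc

/-- A form of the theorem of Hurwitz: a limit of entire functions without zeros in an open set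
has no zeros there, unless it vanishes identically. -/
theorem ne_zero_of_nonvanishing_of_le_nhds {P : Type*} [TopologicalSpace P] {G : P → ℂ → ℂ}
    (hG : Continuous (Function.uncurry G)) (hd : ∀ p, Differentiable ℂ (G p)) {l : Filter P}
    [l.NeBot] {p₀ : P} (hl : l ≤ 𝓝 p₀) (hne : ∃ s, G p₀ s ≠ 0) {U : Set ℂ} (hU : IsOpen U)
    (h : ∀ᶠ p in l, ∀ s ∈ U, G p s ≠ 0) {s₀ : ℂ} (hs₀ : s₀ ∈ U) : G p₀ s₀ ≠ 0 := by
  intro h0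
  have han : AnalyticOnNhd ℂ (G p₀) Set.univ := fun s _ => (hd p₀).analyticAt s
  rcases (han s₀ trivial).eventually_eq_zero_or_eventually_ne_zero with hev | hev
  · obtain ⟨s, hs⟩ := hne
    exact hs (congrFun (han.eq_of_eventuallyEq (g := 0) (fun s _ => analyticAt_const) hev) s)
  obtain ⟨r, hr, hball⟩ : ∃ r > 0, closedBall s₀ r ⊆ {s | s ∈ U ∧ (s ≠ s₀ → G p₀ s ≠ 0)} :=
    nhds_basis_closedBall.mem_iff.1
      (Filter.Eventually.and (hU.mem_nhds hs₀) (eventually_nhdsWithin_iff.1 hev))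
  have hsph : (sphere s₀ r).Nonempty := NormedSpace.sphere_nonempty.2 hr.le
  obtain ⟨s₁, hs₁, hmin⟩ := (isCompact_sphere s₀ r).exists_isMinOn hsph
    (f := fun s => ‖G p₀ s‖) ((hd p₀).continuous.norm.continuousOn)
  have hm : 0 < ‖G p₀ s₁‖ :=
    norm_pos_iff.2 ((hball (sphere_subset_closedBall hs₁)).2 (ne_of_mem_sphere hs₁ hr.ne'))
  set m := ‖G p₀ s₁‖
  have hsphere : ∀ᶠ p in 𝓝 p₀, ∀ s ∈ sphere s₀ r, m / 2 < ‖G p s‖ := by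
    refine (isCompact_sphere s₀ r).eventually_forall_of_forall_eventually fun s hs => ?_
    refine hG.norm.continuousAt.eventually_const_lt ?_
    exact (half_lt_self hm).trans_le (hmin hs)
  have hcenter : ∀ᶠ p in 𝓝 p₀, ‖G p s₀‖ < m / 2 := by
    have hc : Continuous fun p => ‖G p s₀‖ := (hG.comp (by fun_prop : Continuous (·, s₀))).norm
    refine hc.continuousAt.eventually_lt_const ?_
    simpa [h0] using hm
  obtain ⟨p, hp, hp1, hp2⟩ := (h.and ((hsphere.filter_mono hl).and (hcenter.filter_mono hl))).exists
  have hclos : closure (ball s₀ r) = closedBall s₀ r := closure_ball s₀ hr.ne'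
  -- The maximum principle for (G p)⁻¹ contradicts a value at the center smaller than those on the
  -- sphere.
  have hdc : DiffContOnCl ℂ (fun s => (G p s)⁻¹) (ball s₀ r) := by
    refine (hd p).diffContOnCl.inv fun s hs => hp s (hball ?_).1
    rwa [hclos] at hs
  have hle := Complex.norm_le_of_forall_mem_frontier_norm_le isBounded_ball hdc (C := (m / 2)⁻¹)
    (fun s hs => by
      rw [frontier_ball s₀ hr.ne'] at hs
      rw [norm_inv]
      exact inv_anti₀ (half_pos hm) (hp1 s hs).le) (subset_closure (mem_ball_self hr))
  rw [norm_inv] at hle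
  have := (inv_le_inv₀ (norm_pos_iff.2 (hp s₀ hs₀)) (half_pos hm)).1 hle
  linarith

theorem differentiable_det_diagonal_sub {ι : Type*} [Fintype ι] [DecidableEq ι]
    (A : Matrix ι ι ℂ) {w : ℂ → ι → ℂ} (hw : ∀ i, Differentiable ℂ fun s => w s i) :
    Differentiable ℂ fun s => (diagonal (w s) - A).det := by
  simp only [det_apply]
  refine Differentiable.fun_sum fun σ _ => Differentiable.const_smul ?_ _
  refine Differentiable.fun_finsetProd fun i _ => ?_
  by_cases hi : σ i = i
  · simpa [hi] using hw i
  · simp [diagonal_apply_ne _ hi]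

variable {N : ℕ} {A : Matrix (Fin N) (Fin N) ℂ}

theorem eval_genCharPoly (A : Matrix (Fin N) (Fin N) ℂ) (m : Fin N → ℕ) (z : ℂ) :
    (genCharPoly A m).eval z = (diagonal (fun i => z ^ m i) - A).det := by
  rw [genCharPoly, ← Polynomial.coe_evalRingHom, RingHom.map_det]
  congr 1
  ext i j
  by_cases hij : i = j <;> simp [hij, diagonal]

theorem IsUnilossless.det_ne_zero_of_norm_ne_one (h : IsUnilossless A) {m : Fin N → ℕ}
    (hm : ∀ i, 0 < m i) {z : ℂ} (hz : ‖z‖ ≠ 1) : (diagonal (fun i => z ^ m i) - A).det ≠ 0 := by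
  rw [← eval_genCharPoly]
  exact fun h0 => hz (h m hm z h0)

theorem IsUnilossless.det_ne_zero (h : IsUnilossless A) : A.det ≠ 0 := by
  have := h.det_ne_zero_of_norm_ne_one (m := fun _ => 1) (fun _ => one_pos) (z := 0) (by simp)
  simp only [pow_one, diagonal_zero, zero_sub, det_neg] at this
  exact right_ne_zero_of_mul this

/-- The substitution z ↦ z⁻¹ exchanges A and A⁻¹ up to invertible factors and preserves the unit
circle. -/
theorem IsUnilossless.inv (h : IsUnilossless A) : IsUnilossless A⁻¹ := by
  intro m hm z hz
  have hu : IsUnit A.det := h.det_ne_zero.isUnit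
  rw [Polynomial.IsRoot, eval_genCharPoly] at hz
  rcases eq_or_ne z 0 with rfl | hz0
  · have : diagonal (fun i => (0 : ℂ) ^ m i) = (0 : Matrix (Fin N) (Fin N) ℂ) := by
      rw [← diagonal_zero]
      congr 1
      ext i
      exact zero_pow (hm i).ne'
    rw [this, zero_sub, det_neg, mul_eq_zero, or_iff_right (by simp)] at hz
    exact absurd hz (A.isUnit_nonsing_inv_det hu).ne_zero
  by_contra hne
  refine h.det_ne_zero_of_norm_ne_one hm (z := z⁻¹) (by simpa [norm_inv] using hne) ?_
  have hfac : diagonal (fun i => z⁻¹ ^ m i) - A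
      = -(diagonal (fun i => z⁻¹ ^ m i) * (diagonal (fun i => z ^ m i) - A⁻¹) * A) := by
    rw [mul_sub, diagonal_mul_diagonal, sub_mul, mul_assoc, nonsing_inv_mul A hu, mul_one, neg_sub]
    have : (fun i => z⁻¹ ^ m i * z ^ m i) = fun _ => (1 : ℂ) := by
      ext i
      rw [← mul_pow, inv_mul_cancel₀ hz0, one_pow]
    rw [this, diagonal_one, one_mul]
  rw [hfac, det_neg, det_mul, det_mul, hz]
  simp

theorem exists_real_exp_eq {z : ℂ} (h0 : z ≠ 0) (h1 : ‖z‖ < 1) :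
    ∃ lam τ : ℝ, 0 < lam ∧ 0 ≤ τ ∧
      Complex.exp (2 * Real.pi * Complex.I * τ) * Complex.exp (-lam) = z := by
  -- The extra full turn makes τ nonnegative, so that natural number floors of its multiples
  -- approximate it.
  refine ⟨-Real.log ‖z‖, z.arg / (2 * Real.pi) + 1,
    neg_pos.2 (Real.log_neg (norm_pos_iff.2 h0) h1), ?_, ?_⟩
  · have := Complex.neg_pi_lt_arg z
    have h2 : -1 ≤ z.arg / (2 * Real.pi) := by
      rw [le_div_iff₀ (by positivity)]
      linarith [Real.pi_pos]
    linarith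
  · push_cast
    have hpi : (Real.pi : ℂ) ≠ 0 := by exact_mod_cast Real.pi_ne_zero
    rw [show 2 * (Real.pi : ℂ) * Complex.I * (z.arg / (2 * Real.pi) + 1)
        = z.arg * Complex.I + 2 * Real.pi * Complex.I by field_simp,
      Complex.exp_add, Complex.exp_two_pi_mul_I, mul_one, neg_neg, ← Complex.ofReal_exp,
      Real.exp_log (norm_pos_iff.2 h0), mul_comm]
    exact Complex.norm_mul_exp_arg_mul_I z

theorem IsUnilossless.det_ne_zero_of_mem_punctured (h : IsUnilossless A) {z : Fin N → ℂ}
    (h0 : ∀ i, z i ≠ 0) (h1 : ∀ i, ‖z i‖ < 1) : (diagonal z - A).det ≠ 0 := by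
  choose lam τ hlam hτ hz using fun i => exists_real_exp_eq (h0 i) (h1 i)
  -- With ζ = exp(-s/q² + 2πi/q), the multiple of q in m q i drops out of the phase and sets the
  -- decay rate lam i, while ⌊τ i * q⌋₊ sets the phase and is negligible after division by q². The
  -- `+ 1` keeps the delays positive.
  let m : ℕ → Fin N → ℕ := fun q i => q * (⌊lam i * q⌋₊ + 1) + ⌊τ i * q⌋₊
  let G : (Fin N → ℝ) × (Fin N → ℂ) → ℂ → ℂ := fun p s =>
    (diagonal (fun i => p.2 i * Complex.exp (-(s * p.1 i))) - A).det
  let e : ℝ → ℂ := fun t => Complex.exp (2 * Real.pi * Complex.I * t)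
  let p : ℕ → (Fin N → ℝ) × (Fin N → ℂ) := fun q =>
    (fun i => m q i / (q : ℝ) ^ 2, fun i => e (⌊τ i * q⌋₊ / q))
  have hfl : ∀ t : ℝ, 0 ≤ t → Tendsto (fun q : ℕ => (⌊t * q⌋₊ : ℝ) / q) atTop (𝓝 t) :=
    fun t ht => (tendsto_nat_floor_mul_div_atTop ht).comp tendsto_natCast_atTop_atTop
  have hinv : Tendsto (fun q : ℕ => (q : ℝ)⁻¹) atTop (𝓝 0) := tendsto_inv_atTop_nhds_zero_nat
  have hp : Tendsto p atTop (𝓝 (lam, fun i => e (τ i))) := by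
    refine Tendsto.prodMk_nhds (tendsto_pi_nhds.2 fun i => ?_) (tendsto_pi_nhds.2 fun i => ?_)
    · have := ((hfl _ (hlam i).le).add hinv).add ((hfl _ (hτ i)).mul hinv)
      rw [mul_zero, add_zero, add_zero] at this
      refine this.congr' ?_
      filter_upwards [eventually_gt_atTop 0] with q hq
      have : (q : ℝ) ≠ 0 := by exact_mod_cast hq.ne'
      simp only [m]
      push_cast
      field_simp
    · have hc : Continuous e := by fun_prop
      exact (hc.tendsto _).comp (hfl _ (hτ i))
  have hGc : Continuous (Function.uncurry G) := by
    refine Continuous.matrix_det (Continuous.sub (Continuous.matrix_diagonal ?_) continuous_const)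
    fun_prop
  have hGd : ∀ p, Differentiable ℂ (G p) := by
    exact fun p => differentiable_det_diagonal_sub A fun i => by fun_prop
  -- As s → +∞ along the reals, the determinant tends to det (-A) ≠ 0.
  have hne : ∃ s, G (lam, fun i => e (τ i)) s ≠ 0 := by
    have hlim : Tendsto (fun t : ℝ => G (lam, fun i => e (τ i)) t) atTop
        (𝓝 (diagonal (fun _ : Fin N => (0 : ℂ)) - A).det) := by
      have hc : Continuous fun w : Fin N → ℂ => (diagonal w - A).det :=
        Continuous.matrix_det (by fun_prop)
      refine (hc.tendsto (fun _ => 0)).comp (tendsto_pi_nhds.2 fun i => ?_)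
      rw [← mul_zero (e (τ i))]
      refine tendsto_const_nhds.mul ?_
      have : Tendsto (fun t : ℝ => Real.exp (-(t * lam i))) atTop (𝓝 0) :=
        Real.tendsto_exp_neg_atTop_nhds_zero.comp (tendsto_id.atTop_mul_const (hlam i))
      refine ((Complex.continuous_ofReal.tendsto 0).comp this).congr fun t => ?_
      simp
    have hA : (diagonal (fun _ : Fin N => (0 : ℂ)) - A).det ≠ 0 := by
      rw [diagonal_zero, zero_sub, det_neg]
      exact mul_ne_zero (by simp) h.det_ne_zero
    obtain ⟨t, ht⟩ := (hlim.eventually_ne hA).exists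
    exact ⟨t, ht⟩
  have hU : IsOpen {s : ℂ | 0 < s.re} := isOpen_lt continuous_const Complex.continuous_re
  have hev : ∀ᶠ q in atTop, ∀ s ∈ {s : ℂ | 0 < s.re}, G (p q) s ≠ 0 := by
    filter_upwards [eventually_gt_atTop 0] with q hq s hs
    have hq0 : (q : ℂ) ≠ 0 := by exact_mod_cast hq.ne'
    let ζ : ℂ := Complex.exp (-(s / (q : ℂ) ^ 2) + 2 * Real.pi * Complex.I / q)
    have hζ : ‖ζ‖ < 1 := by
      rw [Complex.norm_exp, Real.exp_lt_one_iff]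
      have e1 : (s / (q : ℂ) ^ 2).re = s.re / (q : ℝ) ^ 2 := by
        rw [← Complex.div_ofReal_re]; push_cast; rfl
      have e2 : (2 * Real.pi * Complex.I / (q : ℂ)).re = 0 := by
        rw [← Complex.ofReal_natCast, Complex.div_ofReal_re]; simp
      rw [Complex.add_re, Complex.neg_re, e1, e2]
      have : 0 < s.re / (q : ℝ) ^ 2 := div_pos hs (by positivity)
      linarith
    have hmpos : ∀ i, 0 < m q i := fun i => by simp only [m]; positivity
    have := h.det_ne_zero_of_norm_ne_one hmpos hζ.ne
    convert this using 5 with i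
    simp only [ζ, p, e, ← Complex.exp_nat_mul]
    rw [← Complex.exp_add]
    rw [show (m q i : ℂ) * (-(s / (q : ℂ) ^ 2) + 2 * Real.pi * Complex.I / q)
      = (2 * Real.pi * Complex.I * ((⌊τ i * q⌋₊ / q : ℝ) : ℂ)
          + -(s * ((m q i / (q : ℝ) ^ 2 : ℝ) : ℂ)))
        + ((⌊lam i * q⌋₊ + 1 : ℕ) : ℂ) * (2 * Real.pi * Complex.I) by
      simp only [m]; push_cast; field_simp; ring]
    rw [Complex.exp_add _ (_ * (2 * _ * _)), Complex.exp_nat_mul_two_pi_mul_I, mul_one]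
  have := ne_zero_of_nonvanishing_of_le_nhds hGc hGd hp hne hU (eventually_map.2 hev)
    (s₀ := 1) (by simp)
  simpa only [G, e, one_mul, hz] using this

/-- For a unilossless matrix, `det (diag z - A)` has no zeros in the open unit polydisc. -/
theorem IsUnilossless.det_ne_zero_of_norm_lt_one (h : IsUnilossless A) {z : Fin N → ℂ}
    (h1 : ∀ i, ‖z i‖ < 1) : (diagonal z - A).det ≠ 0 := by
  -- Zero coordinates are perturbed to ε. The others are scaled by s to give a holomorphic variable
  -- for Hurwitz: s = 1 is the point in question and s = 0, ε = 0 gives det (-A) ≠ 0.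
  let G : ℝ → ℂ → ℂ := fun ε s => (diagonal (fun i => if z i = 0 then (ε : ℂ) else s * z i) - A).det
  have hGc : Continuous (Function.uncurry G) := by
    refine Continuous.matrix_det (Continuous.sub (Continuous.matrix_diagonal ?_) continuous_const)
    refine continuous_pi fun i => ?_
    by_cases hi : z i = 0 <;> simp only [hi, if_true, if_false] <;> fun_prop
  have hGd : ∀ p, Differentiable ℂ (G p) := by
    refine fun p => differentiable_det_diagonal_sub A fun i => ?_
    split_ifs <;> fun_prop
  have hne : ∃ s, G 0 s ≠ 0 := by
    refine ⟨0, ?_⟩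
    simp only [G, Complex.ofReal_zero, zero_mul, ite_self, diagonal_zero, zero_sub, det_neg]
    exact mul_ne_zero (by simp) h.det_ne_zero
  let U : Set ℂ := {s | s ≠ 0 ∧ ∀ i, ‖s * z i‖ < 1}
  have hU : IsOpen U := by
    have : U = {s | s ≠ 0} ∩ ⋂ i, {s | ‖s * z i‖ < 1} := by
      ext
      simp [U]
    rw [this]
    exact isOpen_ne.inter
      (isOpen_iInter_of_finite fun i => isOpen_lt (by fun_prop) continuous_const)
  have hev : ∀ᶠ ε in 𝓝[>] (0 : ℝ), ∀ s ∈ U, G ε s ≠ 0 := by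
    filter_upwards [Ioo_mem_nhdsGT one_pos] with ε hε s hs
    refine h.det_ne_zero_of_mem_punctured (fun i => ?_) fun i => ?_
    · split_ifs with hi
      · exact_mod_cast hε.1.ne'
      · exact mul_ne_zero hs.1 hi
    · split_ifs with hi
      · rw [Complex.norm_real, Real.norm_eq_abs, abs_of_pos hε.1]
        exact hε.2
      · exact hs.2 i
  have := ne_zero_of_nonvanishing_of_le_nhds hGc hGd nhdsWithin_le_nhds hne hU hev (s₀ := 1)
    ⟨one_ne_zero, by simpa using h1⟩
  have hz : (fun i => if z i = 0 then ((0 : ℝ) : ℂ) else 1 * z i) = z := by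
    ext i
    split_ifs with hi <;> simp [hi]
  simpa only [G, hz] using this

end Polydisc

end FDN

namespace FDN

open Matrix

/-! ### The Cayley transform -/

section Cayley

variable {ι : Type*} [Fintype ι] [DecidableEq ι]

/-- `det (diag z - A)` does not vanish on the open unit polydisc. -/
def IsPolydiscStable (A : Matrix ι ι ℂ) : Prop :=
  ∀ z : ι → ℂ, (∀ i, ‖z i‖ < 1) → (diagonal z - A).det ≠ 0

theorem IsPolydiscStable.smul {A : Matrix ι ι ℂ} (h : IsPolydiscStable A) {c : ℂ} (hc : ‖c‖ = 1) :
    IsPolydiscStable (c • A) := by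
  intro z hz
  have hc0 : c ≠ 0 := by rintro rfl; simp at hc
  have hfac : diagonal z - c • A = c • (diagonal (fun i => c⁻¹ * z i) - A) := by
    rw [smul_sub, ← diagonal_smul]
    congr 2
    ext i
    simp [hc0]
  rw [hfac, det_smul]
  exact mul_ne_zero (pow_ne_zero _ hc0) (h _ fun i => by simpa [hc] using hz i)

theorem norm_cayley_lt_one {x : ℂ} (hx : 0 < x.im) :
    ‖(x - Complex.I) / (x + Complex.I)‖ < 1 := by
  have h1 : Complex.normSq (x - Complex.I) < Complex.normSq (x + Complex.I) := by
    simp only [Complex.normSq_apply, Complex.sub_re, Complex.sub_im, Complex.add_re,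
      Complex.add_im, Complex.I_re, Complex.I_im]
    nlinarith
  have h0 : 0 ≤ Complex.normSq (x - Complex.I) := Complex.normSq_nonneg _
  rw [norm_div, div_lt_one (norm_pos_iff.2 (Complex.normSq_pos.1 (h0.trans_lt h1)))]
  rw [Complex.normSq_eq_norm_sq, Complex.normSq_eq_norm_sq] at h1
  exact lt_of_pow_lt_pow_left₀ 2 (norm_nonneg _) h1

/-- The map x ↦ (x - i)/(x + i) sends the upper half plane into the disc, and clearing denominators
factors (diag x + R)(1 - B). -/
theorem IsPolydiscStable.isStable {B R : Matrix ι ι ℂ} (h : IsPolydiscStable B)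
    (hR : R * (1 - B) = -(Complex.I • (1 + B))) : IsStable R := by
  intro x hx hdet
  have hx0 : ∀ i, x i + Complex.I ≠ 0 := fun i h0 => by
    have h2 := congrArg Complex.im h0
    have := hx i
    simp at h2
    linarith
  have hfac : diagonal (fun i => x i + Complex.I)
        * (diagonal (fun i => (x i - Complex.I) / (x i + Complex.I)) - B)
      = (diagonal x + R) * (1 - B) := by
    have h1 : diagonal (fun i => x i + Complex.I)
        = diagonal x + Complex.I • (1 : Matrix ι ι ℂ) := by
      rw [← diagonal_add, smul_one_eq_diagonal]
    have h2 : (fun i => (x i + Complex.I) * ((x i - Complex.I) / (x i + Complex.I)))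
        = fun i => x i - Complex.I := by
      ext i
      rw [mul_div_cancel₀ _ (hx0 i)]
    have h3 : diagonal (fun i => x i - Complex.I)
        = diagonal x - Complex.I • (1 : Matrix ι ι ℂ) := by
      rw [← diagonal_sub, smul_one_eq_diagonal]
    rw [mul_sub, diagonal_mul_diagonal, h2, h3, h1, add_mul, add_mul, hR, smul_mul_assoc, one_mul,
      mul_sub, mul_one, smul_add]
    abel
  have hd := congrArg det hfac
  rw [det_mul, det_mul, hdet, zero_mul, det_diagonal, mul_eq_zero] at hd
  rcases hd with hd | hd
  · exact Finset.prod_ne_zero_iff.2 (fun i _ => hx0 i) hd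
  · exact h _ (fun i => norm_cayley_lt_one (hx i)) hd

theorem isBistable_of_cayley {B R : Matrix ι ι ℂ} (h : IsPolydiscStable B)
    (h' : IsPolydiscStable B⁻¹) (hB : IsUnit B.det)
    (hR : R * (1 - B) = -(Complex.I • (1 + B))) : IsBistable R := by
  refine ⟨h.isStable hR, h'.isStable ?_⟩
  -- Replacing B by B⁻¹ replaces R by -R.
  have : -R * (1 - B⁻¹) = R * (1 - B) * B⁻¹ := by
    rw [mul_assoc, sub_mul, mul_nonsing_inv B hB, one_mul, neg_mul, ← mul_neg, neg_sub]
  rw [this, hR, neg_mul, smul_mul_assoc, add_mul, mul_nonsing_inv B hB, one_mul, add_comm]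

/-- Multiply R D = D Rᴴ by 1 - B on the left and its adjoint on the right; the mixed terms cancel
and 2(D - B D Bᴴ) = 0 remains. -/
theorem mul_mul_conjTranspose_of_cayley {B R D : Matrix ι ι ℂ}
    (hR : (1 - B) * R = -(Complex.I • (1 + B))) (hD : R * D = D * Rᴴ) : B * D * Bᴴ = D := by
  have h1 : (1 - B) * (R * D) * (1 - B)ᴴ = -(Complex.I • ((1 + B) * D * (1 - Bᴴ))) := by
    rw [← mul_assoc (1 - B), hR]
    simp only [conjTranspose_sub, conjTranspose_one, neg_mul, smul_mul_assoc]
  have h2 : (1 - B) * (D * Rᴴ) * (1 - B)ᴴ = Complex.I • ((1 - B) * D * (1 + Bᴴ)) := by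
    rw [mul_assoc, mul_assoc D, ← conjTranspose_mul, hR, ← mul_assoc]
    simp only [conjTranspose_neg, conjTranspose_smul, conjTranspose_add, conjTranspose_one,
      mul_smul_comm, Complex.star_def, Complex.conj_I, neg_smul, neg_neg]
  rw [hD, h2] at h1
  have h3 : Complex.I • ((1 - B) * D * (1 + Bᴴ) + (1 + B) * D * (1 - Bᴴ)) = 0 := by
    rw [smul_add, h1]
    simp
  rw [smul_eq_zero, or_iff_right Complex.I_ne_zero] at h3
  have h4 : (2 : ℂ) • (D - B * D * Bᴴ) = 0 := by
    rw [← h3, two_smul]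
    noncomm_ring
  rw [smul_eq_zero, or_iff_right two_ne_zero, sub_eq_zero] at h4
  exact h4.symm

theorem exists_norm_eq_one_det_ne_zero (A : Matrix ι ι ℂ) :
    ∃ c : ℂ, ‖c‖ = 1 ∧ (1 - c • A).det ≠ 0 := by
  have hinf : (Metric.sphere (0 : ℂ) 1).Infinite := by
    refine (isPreconnected_sphere (by simp) 0 1).infinite_of_nontrivial
      ⟨1, by simp, -1, by simp, ?_⟩
    norm_num
  obtain ⟨w, hw, hroot⟩ := hinf.exists_notMem_finset A.charpoly.roots.toFinset
  have hw1 : ‖w‖ = 1 := by simpa using hw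
  have hw0 : w ≠ 0 := by rintro rfl; simp at hw1
  refine ⟨w⁻¹, by simp [hw1], fun h0 => hroot ?_⟩
  rw [Multiset.mem_toFinset, Polynomial.mem_roots A.charpoly_monic.ne_zero, Polynomial.IsRoot,
    eval_charpoly]
  have : scalar ι w - A = w • (1 - w⁻¹ • A) := by
    rw [smul_sub, smul_smul, mul_inv_cancel₀ hw0, one_smul, smul_one_eq_diagonal, scalar_apply]
  rw [this, det_smul, h0, mul_zero]

end Cayley

/-! ### Diagonal symmetrizers -/

section Symmetrizer

theorem IsBistable.exists_symmetrizer {ι : Type*} [Fintype ι] [DecidableEq ι] {R : Matrix ι ι ℂ}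
    (h : IsBistable R) (hconn : ∀ i j, ∃ l, walkWeight R i l j ≠ 0) :
    ∃ d : ι → ℂ, (∀ i, d i ≠ 0) ∧ ∀ i j, R i j * d j = d i * Rᴴ i j := by
  rcases isEmpty_or_nonempty ι with hι | ⟨⟨o⟩⟩
  · exact ⟨0, fun i => isEmptyElim i, fun i => isEmptyElim i⟩
  choose w hw using fun j => hconn o j
  choose u hu using fun j => hconn j o
  have hclosed : ∀ j, walkWeight R o (w j) j * walkWeight R j (u j) o
      = walkWeight Rᴴ o (w j) j * walkWeight Rᴴ j (u j) o := fun j => by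
    rw [← walkWeight_append, ← walkWeight_append, h.walkWeight_closed]
  have hne : ∀ j, walkWeight Rᴴ o (w j) j * walkWeight Rᴴ j (u j) o ≠ 0 := fun j => by
    rw [← hclosed]
    exact mul_ne_zero (hw j) (hu j)
  refine ⟨fun j => walkWeight Rᴴ o (w j) j / walkWeight R o (w j) j,
    fun j => div_ne_zero (left_ne_zero_of_mul (hne j)) (hw j), fun i j => ?_⟩
  -- The closed walk using the edge i, j, compared with the one going to j by `w j`, makes the
  -- common return walk `u j` cancel.
  have hedge := h.walkWeight_closed o (w i ++ i :: j :: u j)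
  simp only [walkWeight_append, walkWeight] at hedge
  have hi := hw i
  have hj := hw j
  field_simp
  refine mul_right_cancel₀ (right_ne_zero_of_mul (hne j)) ?_
  linear_combination walkWeight R o (w j) j * hedge
    - R i j * walkWeight R o (w i) i * hclosed j

variable {N : ℕ} {A : Matrix (Fin N) (Fin N) ℂ}

theorem IsIrreducible.eq_univ_of_closed (h : IsIrreducible A) {S : Set (Fin N)} (hS : S.Nonempty)
    (h0 : ∀ i ∈ S, ∀ j ∉ S, A i j = 0) : S = Set.univ := by
  classical
  by_contra hne
  apply h
  obtain ⟨i, hi⟩ := hS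
  obtain ⟨j, hj⟩ := (Set.ne_univ_iff_exists_notMem S).1 hne
  -- The complement of S comes first, so that the vanishing block lands in the lower left corner.
  let e : Fin (Fintype.card {x // x ∉ S}) ⊕ Fin (Fintype.card {x // ¬ x ∉ S}) ≃ Fin N :=
    (Equiv.sumCongr (Fintype.equivFin _).symm (Fintype.equivFin _).symm).trans
      (Equiv.sumCompl fun x => x ∉ S)
  refine ⟨_, _, Fintype.card_pos_iff.2 ⟨⟨j, hj⟩⟩, Fintype.card_pos_iff.2 ⟨⟨i, not_not.2 hi⟩⟩, e,
    (A.submatrix e e).toBlocks₁₁, (A.submatrix e e).toBlocks₁₂, (A.submatrix e e).toBlocks₂₂, ?_⟩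
  have : (A.submatrix e e).toBlocks₂₁ = 0 := by
    ext x y
    refine h0 _ ?_ _ ?_
    · exact not_not.1 ((Fintype.equivFin {x // ¬ x ∉ S}).symm x).2
    · exact ((Fintype.equivFin {x // x ∉ S}).symm y).2
  rw [← this, fromBlocks_toBlocks]

/-- The inverse Cayley transform preserves the invariant coordinate subspaces. -/
theorem apply_eq_zero_of_cayley {c : ℂ} {R : Matrix (Fin N) (Fin N) ℂ} (hc : c ≠ 0)
    (hR : R * (1 - c • A) = -(Complex.I • (1 + c • A))) {S : Set (Fin N)}
    (h0 : ∀ i ∈ S, ∀ j ∉ S, R i j = 0) : ∀ i ∈ S, ∀ j ∉ S, A i j = 0 := by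
  classical
  have hI : (2 * Complex.I) ≠ 0 := by simp
  -- Since (R - i)(1 - cA) = -2i, the matrix 1 - cA is a multiple of (R - i)⁻¹, and inversion
  -- preserves block triangularity.
  have h1 : (R - Complex.I • 1) * ((-(2 * Complex.I)⁻¹) • (1 - c • A)) = 1 := by
    rw [mul_smul_comm, sub_mul, hR, smul_mul_assoc, one_mul,
      show -(Complex.I • (1 + c • A)) - Complex.I • (1 - c • A)
        = (-(2 * Complex.I)) • (1 : Matrix (Fin N) (Fin N) ℂ) by module, smul_smul]
    rw [neg_mul_neg, inv_mul_cancel₀ hI, one_smul]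
  let b : Fin N → ℕ := fun i => if i ∈ S then 1 else 0
  have hb : ∀ i j, b j < b i ↔ i ∈ S ∧ j ∉ S := fun i j => by
    simp only [b]
    by_cases hi : i ∈ S <;> by_cases hj : j ∈ S <;> simp [hi, hj]
  have htri : BlockTriangular (R - Complex.I • 1) b := by
    intro i j hij
    obtain ⟨hi, hj⟩ := (hb i j).1 hij
    have hne : i ≠ j := by rintro rfl; exact hj hi
    simp [h0 i hi j hj, hne]
  let _ := invertibleOfRightInverse _ _ h1
  have hinv := blockTriangular_inv_of_blockTriangular htri
  rw [inv_eq_right_inv h1] at hinv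
  intro i hi j hj
  have hne : i ≠ j := by rintro rfl; exact hj hi
  have := hinv ((hb i j).2 ⟨hi, hj⟩)
  simpa [hne, hc] using this

/-- The set of vertices reachable from i is closed under outgoing edges. Walks have at least one
edge, so the loop at i is what puts i in it. -/
theorem exists_walkWeight_ne_zero {R : Matrix (Fin N) (Fin N) ℂ} (hd : ∀ i, R i i ≠ 0)
    (hR : ∀ S : Set (Fin N), S.Nonempty → (∀ i ∈ S, ∀ j ∉ S, R i j = 0) → S = Set.univ)
    (i j : Fin N) : ∃ l, walkWeight R i l j ≠ 0 := by
  have := hR {j | ∃ l, walkWeight R i l j ≠ 0} ⟨i, [], hd i⟩ ?_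
  · exact this.symm.subset (Set.mem_univ j)
  · rintro a ⟨l, hl⟩ b hb
    by_contra hab
    refine hb ⟨l ++ [a], ?_⟩
    rw [walkWeight_append]
    exact mul_ne_zero hl hab

end Symmetrizer

end FDN

/-! ### Existence of the diagonal solution -/

theorem theorem8 {N : ℕ} (A : Matrix (Fin N) (Fin N) ℂ)
    (hirr : FDN.IsIrreducible A) (huni : FDN.IsUnilossless A) :
    ∃ E : Matrix (Fin N) (Fin N) ℂ,
      E.IsDiag ∧ IsUnit E ∧ A * E * A.conjTranspose = E := by
  open Matrix FDN in
  obtain ⟨c, hc, hdet⟩ := exists_norm_eq_one_det_ne_zero A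
  have hc0 : c ≠ 0 := by rintro rfl; simp at hc
  have hAu : IsUnit A.det := huni.det_ne_zero.isUnit
  have hQ : IsUnit (1 - c • A).det := hdet.isUnit
  have hB : IsPolydiscStable (c • A) :=
    IsPolydiscStable.smul (fun _ hz => huni.det_ne_zero_of_norm_lt_one hz) hc
  have hB' : IsPolydiscStable (c • A)⁻¹ := by
    have : (c • A)⁻¹ = c⁻¹ • A⁻¹ := inv_eq_right_inv (by
      rw [smul_mul_smul_comm, mul_inv_cancel₀ hc0, mul_nonsing_inv A hAu, one_smul])
    rw [this]
    exact IsPolydiscStable.smul (fun _ hz => huni.inv.det_ne_zero_of_norm_lt_one hz) (by simp [hc])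
  have hBu : IsUnit (c • A).det := by
    rw [det_smul]
    exact ((isUnit_iff_ne_zero.2 hc0).pow _).mul hAu
  let R : Matrix (Fin N) (Fin N) ℂ := -(Complex.I • ((1 + c • A) * (1 - c • A)⁻¹))
  have hR : R * (1 - c • A) = -(Complex.I • (1 + c • A)) := by
    rw [neg_mul, smul_mul_assoc, nonsing_inv_mul_cancel_right _ _ hQ]
  have hR' : (1 - c • A) * R = -(Complex.I • (1 + c • A)) := by
    rw [mul_neg, mul_smul_comm, ← mul_assoc,
      show (1 - c • A) * (1 + c • A) = (1 + c • A) * (1 - c • A) from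
        ((Commute.one_left _).sub_left ((Commute.one_right _).add_right (Commute.refl _))).eq,
      mul_nonsing_inv_cancel_right _ _ hQ]
  have hbi : IsBistable R := isBistable_of_cayley hB hB' hBu hR
  -- A real shift of the diagonal keeps bistability and gives every vertex a loop of weight 1, as
  -- needed for connectivity.
  let u : Fin N → ℝ := fun i => 1 - (R i i).re
  let T := R + diagonal fun i => (u i : ℂ)
  have hT : IsBistable T := hbi.add_diagonal u
  have hTo : ∀ i j, i ≠ j → T i j = R i j := fun i j hij => by simp [T, hij]
  have hTd : ∀ i, T i i ≠ 0 := fun i h0 => by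
    have := congrArg Complex.re h0
    simp [T, u] at this
  obtain ⟨d, hd, hsym⟩ := hT.exists_symmetrizer (exists_walkWeight_ne_zero hTd fun S hS h0 =>
    hirr.eq_univ_of_closed hS (apply_eq_zero_of_cayley hc0 hR fun i hi j hj => by
      rw [← hTo i j (by rintro rfl; exact hj hi)]
      exact h0 i hi j hj))
  refine ⟨diagonal d, isDiag_diagonal d, ?_, ?_⟩
  · rw [isUnit_iff_isUnit_det, det_diagonal, isUnit_iff_ne_zero]
    exact Finset.prod_ne_zero_iff.2 fun i _ => hd i
  · have hD : R * diagonal d = diagonal d * Rᴴ := by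
      ext i j
      rw [mul_diagonal, diagonal_mul]
      -- The symmetrizer was built for T; it also serves R, whose diagonal is real and whose other
      -- entries agree with those of T.
      rcases eq_or_ne i j with rfl | hij
      · have : star (R i i) = R i i := Complex.conj_eq_iff_im.2 (hbi.diag_im_eq_zero i)
        rw [conjTranspose_apply, this, mul_comm]
      · have := hsym i j
        rwa [conjTranspose_apply, hTo i j hij, hTo j i hij.symm] at this
    have := mul_mul_conjTranspose_of_cayley hR' hD
    rw [conjTranspose_smul, smul_mul_assoc, smul_mul_smul_comm] at this
    have hcc : c * star c = 1 := by
      rw [← starRingEnd_apply, Complex.mul_conj, Complex.normSq_eq_norm_sq, hc]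
      norm_num
    rwa [hcc, one_smul] at this
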